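/- Let $G=(V,E)$ be a complete undirected graph on a finite vertex set $V$ with edge lengths $c_e\ge 0$ ($e\in E$) satisfying the triangle inequality, let $r\in V$ be a root, and let $\pi_v\ge 0$ ($v\in V$) be penalties with $\pi_r=0$. For $S\subseteq V$ let $\delta(S)$ be the set of edges with exactly one endpoint in $S$, and write $\delta(v)=\delta(\{v\})$ and $x(F)=\sum_{e\in F}x_e$. Let $(x^*,y^*)\in\mathbb{R}^E\times\mathbb{R}^V$ be an optimal solution of the linear program $$\begin{array}{rrcll} \min & c^\top x+\pi^\top(1-y) &&&\\ & x(\delta(v)) &=& 2y_v & \forall v\in V\setminus\{r\}\\ & x(\delta(r)) &\le& 2 &\\ & x(\delta(S)) &\ge& 2y_v & \forall S\subseteq V\setminus\{r\},\ v\in S\\ & y_r &=& 1 &\\ & x_e &\ge& 0 & \forall e\in E\\ & y_v &\in& [0,1] & \forall v\in V, \end{array}$$ and let $\alpha>0$. If there exists $\gamma\in(0,1]$ such that $$\frac{3}{2\gamma}\cdot c^\top x^*+\sum_{v\in V\colon y^*_v<\gamma}\exp\left(-\frac{3}{4\gamma}y^*_v\right)\cdot\pi_v\;\le\;\alpha\cdot\left(c^\top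 x^*+\pi^\top(1-y^*)\right),$$ then there exists a vertex $v\in V$ with $y^*_v\in(0,1]$ such that this inequality also holds for $\gamma=y^*_v$. -/

import Mathlib

/-- An instance of the (metric) prize-collecting traveling salesperson problem on the complete
undirected graph with vertex set `V`: edge lengths that are nonnegative and satisfy the triangle
inequality, a root, and nonnegative vertex penalties, where the root has penalty `0`.
Edges are the non-diagonal elements of `Sym2 V`; values on the diagonal are never used. -/
structure PCTSPInstance (V : Type*) where
  /-- the root `r` -/
  root : V
  /-- the edge lengths `c` -/
  cost : Sym2 V → ℝ
  /-- the vertex penalties `π` -/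
  penalty : V → ℝ
  cost_nonneg : ∀ u v : V, u ≠ v → 0 ≤ cost s(u, v)
  cost_triangle : ∀ u v w : V, u ≠ v → v ≠ w → u ≠ w →
    cost s(u, w) ≤ cost s(u, v) + cost s(v, w)
  penalty_nonneg : ∀ v : V, 0 ≤ penalty v
  penalty_root : penalty root = 0

namespace PCTSPInstance

variable {V : Type*} [Fintype V] [DecidableEq V]

/-- The edge set of the complete graph on `V`. -/
def edges (V : Type*) [Fintype V] [DecidableEq V] : Finset (Sym2 V) :=
  (⊤ : SimpleGraph V).edgeFinset

/-- The cut `δ(S)`: all edges with precisely one endpoint in `S`. -/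
def cut (S : Finset V) : Finset (Sym2 V) :=
  (edges V).filter fun e => ∃ u ∈ S, ∃ w ∉ S, e = s(u, w)

/-- `x(δ(S))`, the total `x`-weight of the cut `δ(S)`. -/
def cutWeight (x : Sym2 V → ℝ) (S : Finset V) : ℝ :=
  ∑ e ∈ cut S, x e

/-- Feasibility of `(x, y)` for the PCTSP LP relaxation. -/
structure IsFeasible (I : PCTSPInstance V) (x : Sym2 V → ℝ) (y : V → ℝ) : Prop where
  degree_eq : ∀ v : V, v ≠ I.root → cutWeight x {v} = 2 * y v
  degree_root : cutWeight x {I.root} ≤ 2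
  cut_ge : ∀ S : Finset V, I.root ∉ S → ∀ v ∈ S, 2 * y v ≤ cutWeight x S
  y_root : y I.root = 1
  x_nonneg : ∀ e ∈ edges V, 0 ≤ x e
  y_mem : ∀ v : V, y v ∈ Set.Icc (0 : ℝ) 1

/-- The length `cᵀx`. -/
def length (I : PCTSPInstance V) (x : Sym2 V → ℝ) : ℝ :=
  ∑ e ∈ edges V, I.cost e * x e

/-- The objective value `cᵀx + πᵀ(1 - y)` of the PCTSP LP relaxation. -/
def lpValue (I : PCTSPInstance V) (x : Sym2 V → ℝ) (y : V → ℝ) : ℝ :=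
  I.length x + ∑ v : V, I.penalty v * (1 - y v)

/-- `(x, y)` is an optimal solution of the PCTSP LP relaxation. -/
def IsOptimal (I : PCTSPInstance V) (x : Sym2 V → ℝ) (y : V → ℝ) : Prop :=
  I.IsFeasible x y ∧
    ∀ (x' : Sym2 V → ℝ) (y' : V → ℝ), I.IsFeasible x' y' → I.lpValue x y ≤ I.lpValue x' y'

/-- The bound `3 / (2γ) · cᵀx + ∑_{v : y_v < γ} exp(-(3 / (4γ)) y_v) π_v` for a threshold `γ`. -/
noncomputable def thresholdBound (I : PCTSPInstance V) (x : Sym2 V → ℝ) (y : V → ℝ) (γ : ℝ) : ℝ :=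
  3 / (2 * γ) * I.length x +
    ∑ v : V with y v < γ, Real.exp (-(3 / (4 * γ)) * y v) * I.penalty v

end PCTSPInstance

namespace PCTSPInstance

section Cuts

variable {V : Type*} [Fintype V] [DecidableEq V]

/-! Let `η` be the smallest value `y v ≥ γ`. Raising the threshold from `γ` to `η` keeps the set of
summed vertices. The length term drops by `3/2 * (1/γ - 1/η)` times the length, while the
exponentials grow by at most `3/4 * (1/γ - 1/η) * ∑ π_v y_v`, so it suffices that `∑ π_v y_v` over
`y v < γ` is at most the length (`IsOptimal.sum_penalty_le_length`).

That bound compares the optimum with the solution scaled by `1/γ`, with `y` capped at `1`. Capping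
breaks the degree equations; `exists_covers_degree_le` restores them by fractional splitting-off:
the triangle inequality keeps the length from growing, and uncrossing of tight sets shows that a
split is possible while some degree is too large. -/

/-! ### Cut weights and their uncrossing inequalities -/

theorem mem_edges {u w : V} : s(u, w) ∈ edges V ↔ u ≠ w := by
  simp [edges]

theorem mem_cut {S : Finset V} {u w : V} :
    s(u, w) ∈ cut S ↔ (u ∈ S ∧ w ∉ S) ∨ (w ∈ S ∧ u ∉ S) := by
  simp only [cut, Finset.mem_filter, mem_edges]
  constructor
  · rintro ⟨-, a, ha, b, hb, h⟩
    rcases Sym2.eq_iff.1 h with ⟨rfl, rfl⟩ | ⟨rfl, rfl⟩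
    · exact Or.inl ⟨ha, hb⟩
    · exact Or.inr ⟨ha, hb⟩
  · rintro (⟨h1, h2⟩ | ⟨h1, h2⟩)
    · exact ⟨by rintro rfl; exact h2 h1, u, h1, w, h2, rfl⟩
    · exact ⟨by rintro rfl; exact h2 h1, w, h1, u, h2, Sym2.eq_swap⟩

theorem cut_subset_edges (S : Finset V) : cut S ⊆ edges V :=
  Finset.filter_subset _ _

theorem cut_compl (S : Finset V) : cut Sᶜ = cut S := by
  ext e
  induction e using Sym2.ind with
  | h u w => simp only [mem_cut, Finset.mem_compl]; tauto

theorem cutWeight_compl (x : Sym2 V → ℝ) (S : Finset V) : cutWeight x Sᶜ = cutWeight x S := by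
  rw [cutWeight, cut_compl, cutWeight]

theorem cutWeight_eq_sum_edges (x : Sym2 V → ℝ) (S : Finset V) :
    cutWeight x S = ∑ e ∈ edges V, if e ∈ cut S then x e else 0 := by
  rw [← Finset.sum_filter, Finset.filter_mem_eq_inter,
    Finset.inter_eq_right.2 (cut_subset_edges S), cutWeight]

theorem cutWeight_nonneg {x : Sym2 V → ℝ} (hx : 0 ≤ x) (S : Finset V) : 0 ≤ cutWeight x S :=
  Finset.sum_nonneg fun e _ => hx e

theorem cutWeight_add_smul (x d : Sym2 V → ℝ) (δ : ℝ) (S : Finset V) :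
    cutWeight (x + δ • d) S = cutWeight x S + δ * cutWeight d S := by
  simp [cutWeight, Finset.sum_add_distrib, Finset.mul_sum]

theorem cutWeight_inter_add_union_le {x : Sym2 V → ℝ} (hx : 0 ≤ x) (X Y : Finset V) :
    cutWeight x (X ∩ Y) + cutWeight x (X ∪ Y) ≤ cutWeight x X + cutWeight x Y := by
  simp only [cutWeight_eq_sum_edges, ← Finset.sum_add_distrib]
  refine Finset.sum_le_sum fun e _ => ?_
  have he : 0 ≤ x e := hx e
  induction e using Sym2.ind with
  | h u w =>
    simp only [mem_cut, Finset.mem_inter, Finset.mem_union]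
    by_cases h1 : u ∈ X <;> by_cases h2 : u ∈ Y <;> by_cases h3 : w ∈ X <;>
      by_cases h4 : w ∈ Y <;> simp [h1, h2, h3, h4, he]

/-- Strict because the edge `va` joins the intersection to the outside of both sets: it counts twice
on the right and not at all on the left. -/
theorem cutWeight_sdiff_add_sdiff_lt {x : Sym2 V → ℝ} (hx : 0 ≤ x) {X Y : Finset V} {a v : V}
    (haX : a ∈ X) (haY : a ∈ Y) (hvX : v ∉ X) (hvY : v ∉ Y) (hpos : 0 < x s(v, a)) :
    cutWeight x (X \ Y) + cutWeight x (Y \ X) < cutWeight x X + cutWeight x Y := by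
  simp only [cutWeight_eq_sum_edges, ← Finset.sum_add_distrib]
  refine Finset.sum_lt_sum (fun e _ => ?_) ⟨s(v, a), ?_, ?_⟩
  · have he : 0 ≤ x e := hx e
    induction e using Sym2.ind with
    | h u w =>
      simp only [mem_cut, Finset.mem_sdiff]
      by_cases h1 : u ∈ X <;> by_cases h2 : u ∈ Y <;> by_cases h3 : w ∈ X <;>
        by_cases h4 : w ∈ Y <;> simp [h1, h2, h3, h4, he]
  · exact mem_edges.2 (by rintro rfl; exact hvX haX)
  · simp [mem_cut, haX, haY, hvX, hvY, hpos]

/-- If every neighbour of `v` lies in `X`, then moving `v` into `X` removes its degree. -/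
theorem cutWeight_eq_insert_add {x : Sym2 V → ℝ} (hx : 0 ≤ x) {X : Finset V} {v : V}
    (hv : v ∉ X) (hN : ∀ b, b ≠ v → 0 < x s(v, b) → b ∈ X) :
    cutWeight x X = cutWeight x (insert v X) + cutWeight x {v} := by
  simp only [cutWeight_eq_sum_edges, ← Finset.sum_add_distrib]
  refine Finset.sum_congr rfl fun e he => ?_
  have key : ∀ b, b ≠ v → b ∉ X → x s(v, b) = 0 := fun b hb hbX =>
    le_antisymm (not_lt.1 fun h => hbX (hN b hb h)) (hx _)
  induction e using Sym2.ind with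
  | h u w =>
    have huw := mem_edges.1 he
    simp only [mem_cut, Finset.mem_insert, Finset.mem_singleton]
    by_cases hu : u = v
    · subst hu
      have hw : w ≠ u := huw.symm
      by_cases hwX : w ∈ X
      · simp [hwX, hv, hw]
      · simp [hwX, hv, hw, key w hw hwX]
    · by_cases hw : w = v
      · subst hw
        by_cases huX : u ∈ X
        · simp [huX, hv, hu]
        · simp [huX, hv, hu, Sym2.eq_swap (a := u), key u hu huX]
      · simp [hu, hw]

/-! ### Cut requirements and tight sets -/

/-- Every cut separating `u` from `w` has weight at least `2 * min (y u) (y w)`. -/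
def Covers (x : Sym2 V → ℝ) (y : V → ℝ) : Prop :=
  ∀ S : Finset V, ∀ u ∈ S, ∀ w ∉ S, 2 * min (y u) (y w) ≤ cutWeight x S

/-- The cut of `S` is as small as the requirement of some separated pair. -/
def IsTight (x : Sym2 V → ℝ) (y : V → ℝ) (S : Finset V) : Prop :=
  ∃ u ∈ S, ∃ w ∉ S, cutWeight x S ≤ 2 * min (y u) (y w)

/-- `m` is a lower bound for the cut requirement of `S` induced by `y`. -/
def RequiresAtLeast (y : V → ℝ) (S : Finset V) (m : ℝ) : Prop :=
  ∃ u ∈ S, ∃ w ∉ S, m ≤ min (y u) (y w)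

theorem RequiresAtLeast.compl {y : V → ℝ} {S : Finset V} {m : ℝ} (h : RequiresAtLeast y S m) :
    RequiresAtLeast y Sᶜ m := by
  obtain ⟨u, hu, w, hw, h⟩ := h
  exact ⟨w, by simpa, u, by simpa, by rwa [min_comm]⟩

/-- Skew supermodularity when an element of largest value avoids both sets. -/
theorem skew_supermodular_of_notMem (y : V → ℝ) {X Y : Finset V} {m n : ℝ} {r p s : V}
    (hrX : r ∉ X) (hrY : r ∉ Y) (hp : p ∈ X) (hs : s ∈ Y)
    (hmp : m ≤ y p) (hns : n ≤ y s) (hmr : m ≤ y r) (hnr : n ≤ y r) :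
    (∃ m' n', m + n ≤ m' + n' ∧ RequiresAtLeast y (X ∩ Y) m' ∧ RequiresAtLeast y (X ∪ Y) n') ∨
    (∃ m' n', m + n ≤ m' + n' ∧ RequiresAtLeast y (X \ Y) m' ∧ RequiresAtLeast y (Y \ X) n') := by
  have hr1 : r ∉ X ∩ Y := by simp [hrX]
  have hr2 : r ∉ X ∪ Y := by simp [hrX, hrY]
  have hpU : p ∈ X ∪ Y := Finset.mem_union_left _ hp
  have hsU : s ∈ X ∪ Y := Finset.mem_union_right _ hs
  by_cases hpY : p ∈ Y
  · exact Or.inl ⟨m, n, le_rfl, ⟨p, by simp [hp, hpY], r, hr1, le_min hmp hmr⟩,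
      ⟨s, hsU, r, hr2, le_min hns hnr⟩⟩
  · by_cases hsX : s ∈ X
    · exact Or.inl ⟨n, m, (add_comm m n).le, ⟨s, by simp [hs, hsX], r, hr1, le_min hns hnr⟩,
        ⟨p, hpU, r, hr2, le_min hmp hmr⟩⟩
    · exact Or.inr ⟨m, n, le_rfl, ⟨p, by simp [hp, hpY], r, by simp [hrX], le_min hmp hmr⟩,
        ⟨s, by simp [hs, hsX], r, by simp [hrY], le_min hns hnr⟩⟩

/-- Requirements are invariant under complement, so each set may be replaced by one that avoids a
maximizer `r` of `y`. Complementing just one of the sets swaps the two alternatives. -/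
theorem skew_supermodular (y : V → ℝ) {X Y : Finset V} {m n : ℝ}
    (hX : RequiresAtLeast y X m) (hY : RequiresAtLeast y Y n) :
    (∃ m' n', m + n ≤ m' + n' ∧ RequiresAtLeast y (X ∩ Y) m' ∧ RequiresAtLeast y (X ∪ Y) n') ∨
    (∃ m' n', m + n ≤ m' + n' ∧ RequiresAtLeast y (X \ Y) m' ∧ RequiresAtLeast y (Y \ X) n') := by
  obtain ⟨p, hp, q, hq, hpq⟩ := hX
  obtain ⟨s, hs, t, ht, hst⟩ := hY
  obtain ⟨hmp, hmq⟩ := le_min_iff.1 hpq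
  obtain ⟨hns, hnt⟩ := le_min_iff.1 hst
  obtain ⟨r, -, hr⟩ := Finset.exists_max_image Finset.univ y ⟨p, Finset.mem_univ p⟩
  have hmr := hmp.trans (hr p (Finset.mem_univ p))
  have hnr := hns.trans (hr s (Finset.mem_univ s))
  have c1 : Xᶜ ∩ Yᶜ = (X ∪ Y)ᶜ := by ext; simp
  have c2 : Xᶜ ∪ Yᶜ = (X ∩ Y)ᶜ := by ext; simp
  have c3 : Xᶜ \ Yᶜ = Y \ X := by ext; simp; tauto
  have c4 : Yᶜ \ Xᶜ = X \ Y := by ext; simp; tauto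
  have d1 : X ∩ Yᶜ = X \ Y := by ext; simp
  have d2 : X ∪ Yᶜ = (Y \ X)ᶜ := by ext; simp; tauto
  have d3 : X \ Yᶜ = X ∩ Y := by ext; simp
  have d4 : Yᶜ \ X = (X ∪ Y)ᶜ := by ext; simp; tauto
  have e1 : Xᶜ ∩ Y = Y \ X := by ext; simp; tauto
  have e2 : Xᶜ ∪ Y = (X \ Y)ᶜ := by ext; simp; tauto
  have e3 : Xᶜ \ Y = (X ∪ Y)ᶜ := by ext; simp
  have e4 : Y \ Xᶜ = X ∩ Y := by ext; simp; tauto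
  by_cases hrX : r ∈ X <;> by_cases hrY : r ∈ Y
  · rcases skew_supermodular_of_notMem y (X := Xᶜ) (Y := Yᶜ) (by simpa) (by simpa)
      (Finset.mem_compl.2 hq) (Finset.mem_compl.2 ht) hmq hnt hmr hnr with
      ⟨m', n', h, h1, h2⟩ | ⟨m', n', h, h1, h2⟩
    · rw [c1] at h1; rw [c2] at h2
      exact Or.inl ⟨n', m', by linarith, by simpa using h2.compl, by simpa using h1.compl⟩
    · rw [c3] at h1; rw [c4] at h2
      exact Or.inr ⟨n', m', by linarith, h2, h1⟩
  · rcases skew_supermodular_of_notMem y (X := Xᶜ) (Y := Y) (by simpa) hrY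
      (Finset.mem_compl.2 hq) hs hmq hns hmr hnr with
      ⟨m', n', h, h1, h2⟩ | ⟨m', n', h, h1, h2⟩
    · rw [e1] at h1; rw [e2] at h2
      exact Or.inr ⟨n', m', by linarith, by simpa using h2.compl, h1⟩
    · rw [e3] at h1; rw [e4] at h2
      exact Or.inl ⟨n', m', by linarith, h2, by simpa using h1.compl⟩
  · rcases skew_supermodular_of_notMem y (X := X) (Y := Yᶜ) hrX (by simpa)
      hp (Finset.mem_compl.2 ht) hmp hnt hmr hnr with
      ⟨m', n', h, h1, h2⟩ | ⟨m', n', h, h1, h2⟩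
    · rw [d1] at h1; rw [d2] at h2
      exact Or.inr ⟨m', n', h, h1, by simpa using h2.compl⟩
    · rw [d3] at h1; rw [d4] at h2
      exact Or.inl ⟨m', n', h, h1, by simpa using h2.compl⟩
  · exact skew_supermodular_of_notMem y hrX hrY hp hs hmp hns hmr hnr

theorem Covers.two_mul_le {x : Sym2 V → ℝ} {y : V → ℝ} (h : Covers x y) {S : Finset V} {m : ℝ}
    (hm : RequiresAtLeast y S m) : 2 * m ≤ cutWeight x S := by
  obtain ⟨u, hu, w, hw, hm⟩ := hm
  linarith [h S u hu w hw]

/-- Tight sets avoiding `v` and sharing a neighbour of `v` have a tight union. -/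
theorem IsTight.union {x : Sym2 V → ℝ} {y : V → ℝ} (hx : 0 ≤ x) (hc : Covers x y)
    {X Y : Finset V} (hX : IsTight x y X) (hY : IsTight x y Y) {a v : V}
    (haX : a ∈ X) (haY : a ∈ Y) (hvX : v ∉ X) (hvY : v ∉ Y) (hpos : 0 < x s(v, a)) :
    IsTight x y (X ∪ Y) := by
  obtain ⟨p, hp, q, hq, h1⟩ := hX
  obtain ⟨s, hs, t, ht, h2⟩ := hY
  rcases skew_supermodular y (X := X) (Y := Y) ⟨p, hp, q, hq, le_rfl⟩ ⟨s, hs, t, ht, le_rfl⟩ with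
    ⟨m', n', h, h3, h4⟩ | ⟨m', n', h, h3, h4⟩
  · have h5 := hc.two_mul_le h3
    have h6 := cutWeight_inter_add_union_le hx X Y
    obtain ⟨u, hu, w, hw, hn⟩ := h4
    exact ⟨u, hu, w, hw, by linarith⟩
  · have h5 := hc.two_mul_le h3
    have h6 := hc.two_mul_le h4
    have h7 := cutWeight_sdiff_add_sdiff_lt hx haX haY hvX hvY hpos
    linarith

/-- If the degree of `v` exceeds its requirement, some splitting at `v` meets no tight set. -/
theorem degree_le_of_forall_tight {x : Sym2 V → ℝ} {y : V → ℝ} (hx : 0 ≤ x) (hy : 0 ≤ y)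
    (hc : Covers x y) (v : V)
    (hT : ∀ a b, a ≠ v → b ≠ v → 0 < x s(v, a) → 0 < x s(v, b) →
      ∃ S : Finset V, v ∉ S ∧ a ∈ S ∧ b ∈ S ∧ IsTight x y S) :
    cutWeight x {v} ≤ 2 * y v := by
  by_contra! hdeg
  have hdpos : 0 < cutWeight x {v} := lt_of_le_of_lt (by linarith [show 0 ≤ y v from hy v]) hdeg
  obtain ⟨a, hav, ha⟩ : ∃ a, a ≠ v ∧ 0 < x s(v, a) := by
    by_contra! h
    have h0 := cutWeight_eq_insert_add hx (X := ∅) (v := v) (by simp)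
      (fun b hb hb' => absurd hb' (not_lt.2 (h b hb)))
    have h1 := cutWeight_nonneg hx (insert v ∅)
    have h2 : cutWeight x ∅ = 0 := by simp [cutWeight, cut]
    linarith
  let F : Finset (Finset V) := by
    classical exact Finset.univ.filter fun S => v ∉ S ∧ a ∈ S ∧ IsTight x y S
  have hF : F.Nonempty := by
    obtain ⟨S, h1, h2, -, h3⟩ := hT a a hav hav ha ha
    exact ⟨S, by simp [F, h1, h2, h3]⟩
  obtain ⟨X, hXF, hmax⟩ := Finset.exists_max_image F Finset.card hF
  obtain ⟨hvX, haX, hX⟩ : v ∉ X ∧ a ∈ X ∧ IsTight x y X := by simpa [F] using hXF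
  -- Otherwise adding `v` to `X` would lower its cut by the whole degree of `v`, which exceeds `2 *
  -- y v`, contradicting tightness of `X`.
  obtain ⟨b, hbv, hb, hbX⟩ : ∃ b, b ≠ v ∧ 0 < x s(v, b) ∧ b ∉ X := by
    by_contra! h
    have h0 := cutWeight_eq_insert_add hx hvX h
    obtain ⟨u, hu, w, hw, h1⟩ := hX
    by_cases hwv : w = v
    · subst hwv
      have h2 := cutWeight_nonneg hx (insert w X)
      have h3 := min_le_right (y u) (y w)
      linarith
    · have h2 := hc (insert v X) u (by simp [hu]) w (by simp [hw, hwv])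
      linarith
  obtain ⟨Y, hvY, haY, hbY, hY⟩ := hT a b hav hbv ha hb
  have hU := hX.union hx hc hY haX haY hvX hvY ha
  have hlt : X.card < (X ∪ Y).card := Finset.card_lt_card
    (Finset.ssubset_iff_of_subset Finset.subset_union_left |>.2 ⟨b, by simp [hbY], hbX⟩)
  exact absurd (hmax (X ∪ Y) (by simp [F, hvX, hvY, haX, hU])) (not_le.2 hlt)

/-! ### Fractional splitting-off -/

/-- The direction that replaces the edges `va` and `vb` by the edge `ab`. -/
def splitDir (v a b : V) : Sym2 V → ℝ :=
  Pi.single s(a, b) 1 - Pi.single s(v, a) 1 - Pi.single s(v, b) 1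

theorem sum_splitDir (v a b : V) : ∑ e, splitDir v a b e = -1 := by
  simp [splitDir, Finset.sum_sub_distrib]

theorem cutWeight_splitDir (v a b : V) (S : Finset V) :
    cutWeight (splitDir v a b) S = (if s(a, b) ∈ cut S then 1 else 0) -
      (if s(v, a) ∈ cut S then 1 else 0) - (if s(v, b) ∈ cut S then 1 else 0) := by
  simp [cutWeight, splitDir, Finset.sum_sub_distrib]

/-- The excluded cases are those where `va` and `vb` cross the cut and `ab` does not. -/
theorem cutWeight_splitDir_nonneg {v a b : V} {S : Finset V}
    (h1 : ¬(v ∉ S ∧ a ∈ S ∧ b ∈ S)) (h2 : ¬(v ∈ S ∧ a ∉ S ∧ b ∉ S)) :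
    0 ≤ cutWeight (splitDir v a b) S := by
  rw [cutWeight_splitDir]
  simp only [mem_cut]
  by_cases hv : v ∈ S <;> by_cases ha : a ∈ S <;> by_cases hb : b ∈ S <;> simp_all

theorem length_add_smul (I : PCTSPInstance V) (x d : Sym2 V → ℝ) (δ : ℝ) :
    I.length (x + δ • d) = I.length x + δ * I.length d := by
  simp only [length, Pi.add_apply, Pi.smul_apply, smul_eq_mul, mul_add, Finset.sum_add_distrib,
    Finset.mul_sum]
  congr 1
  exact Finset.sum_congr rfl fun e _ => by ring

theorem length_splitDir_nonpos (I : PCTSPInstance V) {v a b : V} (ha : a ≠ v) (hb : b ≠ v) :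
    I.length (splitDir v a b) ≤ 0 := by
  have h : I.length (splitDir v a b) = (if s(a, b) ∈ edges V then I.cost s(a, b) else 0) -
      (if s(v, a) ∈ edges V then I.cost s(v, a) else 0) -
      (if s(v, b) ∈ edges V then I.cost s(v, b) else 0) := by
    simp [length, splitDir, mul_sub, Finset.sum_sub_distrib, Pi.single_apply]
  rw [h]
  simp only [mem_edges, ha.symm, hb.symm, ne_eq, not_false_eq_true, if_true]
  have h1 := I.cost_nonneg v a ha.symm
  have h2 := I.cost_nonneg v b hb.symm
  by_cases hab : a = b
  · simp only [hab, not_true_eq_false, if_false] at *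
    linarith
  · have h3 := I.cost_triangle a v b ha hb.symm hab
    rw [Sym2.eq_swap (a := a) (b := v)] at h3
    simp only [hab, not_false_eq_true, if_true]
    linarith

/-- Unless a tight set separates `v` from `a` and `b`, a little of `va` and `vb` can be split. -/
theorem exists_covers_add_splitDir {x : Sym2 V → ℝ} {y : V → ℝ} (hx : 0 ≤ x) (hc : Covers x y)
    {v a b : V} (ha : 0 < x s(v, a)) (hb : 0 < x s(v, b))
    (hT : ∀ S : Finset V, v ∉ S → a ∈ S → b ∈ S → ¬IsTight x y S) :
    ∃ δ : ℝ, 0 < δ ∧ 0 ≤ x + δ • splitDir v a b ∧ Covers (x + δ • splitDir v a b) y := by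
  have tend : ∀ c d : ℝ, Filter.Tendsto (fun δ : ℝ => c + δ * d) (nhdsWithin 0 (Set.Ioi 0))
      (nhds c) := fun c d => by
    have : Continuous fun δ : ℝ => c + δ * d := by fun_prop
    simpa using (this.tendsto 0).mono_left nhdsWithin_le_nhds
  have hpos : ∀ᶠ δ in nhdsWithin (0 : ℝ) (Set.Ioi 0), 0 < δ := self_mem_nhdsWithin
  have h1 : ∀ᶠ δ in nhdsWithin (0 : ℝ) (Set.Ioi 0), ∀ e, 0 ≤ x e + δ * splitDir v a b e := by
    refine Filter.eventually_all.2 fun e => ?_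
    -- Only `va` and `vb` can decrease, and both have positive weight.
    by_cases he : 0 < x e
    · exact ((tend (x e) (splitDir v a b e)).eventually (lt_mem_nhds he)).mono fun _ => le_of_lt
    · have hea : e ≠ s(v, a) := by rintro rfl; exact he ha
      have heb : e ≠ s(v, b) := by rintro rfl; exact he hb
      have hd : 0 ≤ splitDir v a b e := by
        simp only [splitDir, Pi.sub_apply, Pi.single_apply, hea, heb, if_false, sub_zero]
        split_ifs <;> norm_num
      filter_upwards [hpos] with δ hδ
      exact add_nonneg (hx e) (mul_nonneg hδ.le hd)
  have h2 : ∀ᶠ δ in nhdsWithin (0 : ℝ) (Set.Ioi 0), ∀ (S : Finset V) (u w : V), u ∈ S → w ∉ S →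
      2 * min (y u) (y w) ≤ cutWeight x S + δ * cutWeight (splitDir v a b) S := by
    refine Filter.eventually_all.2 fun S => Filter.eventually_all.2 fun u =>
      Filter.eventually_all.2 fun w => ?_
    by_cases hu : u ∈ S
    swap
    · simp [hu]
    by_cases hw : w ∈ S
    · simp [hw]
    have strict : 2 * min (y u) (y w) < cutWeight x S →
        ∀ᶠ δ in nhdsWithin (0 : ℝ) (Set.Ioi 0), u ∈ S → w ∉ S →
          2 * min (y u) (y w) ≤ cutWeight x S + δ * cutWeight (splitDir v a b) S := fun h =>
      ((tend _ (cutWeight (splitDir v a b) S)).eventually (lt_mem_nhds h)).mono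
        fun _ h _ _ => h.le
    by_cases hA : v ∉ S ∧ a ∈ S ∧ b ∈ S
    · exact strict (not_le.1 fun h => hT S hA.1 hA.2.1 hA.2.2 ⟨u, hu, w, hw, h⟩)
    by_cases hB : v ∈ S ∧ a ∉ S ∧ b ∉ S
    · refine strict (not_le.1 fun h => hT Sᶜ (by simpa using hB.1) (by simpa using hB.2.1)
        (by simpa using hB.2.2) ⟨w, by simpa, u, by simpa, ?_⟩)
      rwa [cutWeight_compl, min_comm]
    filter_upwards [hpos] with δ hδ _ _
    have h3 := hc S u hu w hw
    have h4 := mul_nonneg hδ.le (cutWeight_splitDir_nonneg hA hB)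
    linarith
  obtain ⟨δ, hδ, h1, h2⟩ := (hpos.and (h1.and h2)).exists
  refine ⟨δ, hδ, fun e => by simpa using h1 e, fun S u hu w hw => ?_⟩
  rw [cutWeight_add_smul]
  exact h2 S u w hu hw

/-- Fractional splitting-off: degrees can be reduced to the requirements without increasing the
length and without violating a cut requirement. -/
theorem exists_covers_degree_le (I : PCTSPInstance V) {x : Sym2 V → ℝ} {y : V → ℝ}
    (hx : 0 ≤ x) (hy : 0 ≤ y) (hc : Covers x y) :
    ∃ z : Sym2 V → ℝ, 0 ≤ z ∧ Covers z y ∧ I.length z ≤ I.length x ∧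
      ∀ v, cutWeight z {v} ≤ 2 * y v := by
  -- The bound on the total weight makes `K` compact. Diagonal entries are counted too, so a split
  -- by `δ` lowers the total by exactly `δ` even when `a = b`.
  let K : Set (Sym2 V → ℝ) := {z | 0 ≤ z ∧ Covers z y ∧ I.length z ≤ I.length x ∧
    ∑ e, z e ≤ ∑ e, x e}
  have hcut : ∀ S : Finset V, Continuous fun z : Sym2 V → ℝ => cutWeight z S := fun S => by
    unfold cutWeight; fun_prop
  have hlen : Continuous fun z : Sym2 V → ℝ => I.length z := by unfold length; fun_prop
  have hsum : Continuous fun z : Sym2 V → ℝ => ∑ e, z e := by fun_prop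
  have hclosed : IsClosed K := by
    refine (isClosed_le continuous_const continuous_id).inter (IsClosed.inter ?_
      ((isClosed_le hlen continuous_const).inter (isClosed_le hsum continuous_const)))
    change IsClosed {z : Sym2 V → ℝ | Covers z y}
    simp only [Covers, Set.ofPred_forall]
    exact isClosed_iInter fun S => isClosed_iInter fun u => isClosed_iInter fun _ =>
      isClosed_iInter fun w => isClosed_iInter fun _ => isClosed_le continuous_const (hcut S)
  have hcompact : IsCompact K := by
    refine (isCompact_Icc (a := (0 : Sym2 V → ℝ)) (b := fun _ => ∑ e, x e)).of_isClosed_subset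
      hclosed fun z hz => ⟨hz.1, fun e => ?_⟩
    exact (Finset.single_le_sum (fun i _ => hz.1 i) (Finset.mem_univ e)).trans hz.2.2.2
  obtain ⟨z, ⟨hz0, hzc, hzl, hzs⟩, hmin⟩ :=
    hcompact.exists_isMinOn ⟨x, hx, hc, le_rfl, le_rfl⟩ hsum.continuousOn
  refine ⟨z, hz0, hzc, hzl, fun v => degree_le_of_forall_tight hz0 hy hzc v
    fun a b hav hbv ha hb => ?_⟩
  by_contra! hT
  obtain ⟨δ, hδ, h0, h1⟩ := exists_covers_add_splitDir hz0 hzc ha hb hT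
  have hs : ∑ e, (z + δ • splitDir v a b) e = ∑ e, z e - δ := by
    simp only [Pi.add_apply, Pi.smul_apply, smul_eq_mul, Finset.sum_add_distrib,
      ← Finset.mul_sum, sum_splitDir]
    ring
  have hl : I.length (z + δ • splitDir v a b) ≤ I.length z := by
    rw [length_add_smul]
    have := mul_nonpos_of_nonneg_of_nonpos hδ.le (I.length_splitDir_nonpos hav hbv)
    linarith
  have : ∑ e, z e ≤ ∑ e, (z + δ • splitDir v a b) e :=
    hmin (show z + δ • splitDir v a b ∈ K from ⟨h0, h1, hl.trans hzl, by linarith⟩)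
  linarith

/-! ### Scaled solutions and the penalty bound -/

theorem IsFeasible.length_nonneg {I : PCTSPInstance V} {x : Sym2 V → ℝ} {y : V → ℝ}
    (h : I.IsFeasible x y) : 0 ≤ I.length x := by
  refine Finset.sum_nonneg fun e he => mul_nonneg ?_ (h.x_nonneg e he)
  induction e using Sym2.ind with
  | h u w => exact I.cost_nonneg u w (mem_edges.1 he)

/-- Scaling a feasible solution by `1 / γ` and capping at `1` yields a feasible solution. -/
theorem IsFeasible.exists_scaled {I : PCTSPInstance V} {x : Sym2 V → ℝ} {y : V → ℝ}
    (h : I.IsFeasible x y) {γ : ℝ} (hγ : 0 < γ) (hγ1 : γ ≤ 1) :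
    ∃ z : Sym2 V → ℝ, I.IsFeasible z (fun v => min 1 (y v / γ)) ∧
      I.length z ≤ I.length x / γ := by
  -- Feasibility does not control diagonal values, but splitting-off needs nonnegativity everywhere.
  let x' : Sym2 V → ℝ := fun e => if e ∈ edges V then x e / γ else 0
  let y' : V → ℝ := fun v => min 1 (y v / γ)
  have hy'1 : ∀ v, y' v ≤ 1 := fun v => min_le_left _ _
  have hy'0 : 0 ≤ y' := fun v => le_min zero_le_one (div_nonneg (h.y_mem v).1 hγ.le)
  have hy'r : y' I.root = 1 := min_eq_left (by rw [h.y_root]; exact (one_le_div hγ).2 hγ1)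
  have hx' : 0 ≤ x' := fun e => by
    by_cases he : e ∈ edges V
    · simpa [x', he] using div_nonneg (h.x_nonneg e he) hγ.le
    · simp [x', he]
  have hcut : ∀ S, cutWeight x' S = cutWeight x S / γ := fun S => by
    rw [cutWeight, cutWeight, Finset.sum_div]
    exact Finset.sum_congr rfl fun e he => if_pos (cut_subset_edges S he)
  have hlen : I.length x' = I.length x / γ := by
    rw [length, length, Finset.sum_div]
    exact Finset.sum_congr rfl fun e he => by simp only [x', he, if_true]; ring
  have hroot : ∀ S : Finset V, I.root ∉ S → ∀ u ∈ S, 2 * y' u ≤ cutWeight x' S :=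
    fun S hS u hu => by
      have h1 : y' u ≤ y u / γ := min_le_right _ _
      have h2 := div_le_div_of_nonneg_right (h.cut_ge S hS u hu) hγ.le
      rw [mul_div_assoc] at h2
      rw [hcut]
      linarith
  have hc : Covers x' y' := fun S u hu w hw => by
    by_cases hS : I.root ∈ S
    · have h1 := hroot Sᶜ (by simpa) w (by simpa)
      rw [cutWeight_compl] at h1
      linarith [min_le_right (y' u) (y' w)]
    · linarith [hroot S hS u hu, min_le_left (y' u) (y' w)]
  obtain ⟨z, hz0, hzc, hzl, hzd⟩ := I.exists_covers_degree_le hx' hy'0 hc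
  have hge : ∀ S : Finset V, I.root ∉ S → ∀ v ∈ S, 2 * y' v ≤ cutWeight z S :=
    fun S hS v hv => by
      -- Pairing with the root, where `y'` is `1`, turns the pairwise requirement back into the LP
      -- cut constraint.
      have h1 := hzc S v hv I.root hS
      rwa [hy'r, min_eq_left (hy'1 v)] at h1
  refine ⟨z, ⟨fun v hv => le_antisymm (hzd v) (hge {v} (by simpa using hv.symm) v (by simp)), ?_,
    hge, hy'r, fun e _ => hz0 e, fun v => ⟨hy'0 v, hy'1 v⟩⟩, hzl.trans hlen.le⟩
  have h1 := hzd I.root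
  rw [hy'r] at h1
  linarith

/-- Passing to the scaled solution costs at most `1/γ - 1` times the length and saves at least `1/γ
- 1` times the sum; vertices with `y v ≥ γ` can only save more. -/
theorem IsOptimal.sum_penalty_le_length {I : PCTSPInstance V} {x : Sym2 V → ℝ} {y : V → ℝ}
    (h : I.IsOptimal x y) {γ : ℝ} (hγ : 0 < γ) (hγ1 : γ < 1) :
    ∑ v : V with y v < γ, I.penalty v * y v ≤ I.length x := by
  obtain ⟨z, hz, hzl⟩ := h.1.exists_scaled hγ hγ1.le
  have hle := h.2 _ _ hz
  simp only [lpValue] at hle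
  have hinv : 0 < 1 / γ - 1 := by
    have := (one_lt_div hγ).2 hγ1
    linarith
  have hterm : ∑ v : V with y v < γ, (1 / γ - 1) * (I.penalty v * y v) ≤
      ∑ v, (I.penalty v * (1 - y v) - I.penalty v * (1 - min 1 (y v / γ))) := by
    rw [Finset.sum_filter]
    refine Finset.sum_le_sum fun v _ => ?_
    have hp := I.penalty_nonneg v
    split_ifs with hv
    · rw [min_eq_right ((div_le_one hγ).2 hv.le)]
      exact le_of_eq (by ring)
    · rw [min_eq_left ((one_le_div hγ).2 (not_lt.1 hv))]
      have := mul_nonneg hp (sub_nonneg.2 (h.1.y_mem v).2)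
      linarith
  rw [← Finset.mul_sum, Finset.sum_sub_distrib] at hterm
  refine le_of_mul_le_mul_left ?_ hinv
  have : (1 / γ - 1) * I.length x = I.length x / γ - I.length x := by ring
  linarith

end Cuts

end PCTSPInstance

/-! ### Comparing thresholds -/

theorem exp_neg_sub_exp_neg_le {s t : ℝ} (hs : 0 ≤ s) (hst : s ≤ t) :
    Real.exp (-s) - Real.exp (-t) ≤ t - s := by
  have h1 : Real.exp (-t) = Real.exp (-s) * Real.exp (-(t - s)) := by
    rw [← Real.exp_add]; congr 1; ring
  have h2 : Real.exp (-s) ≤ 1 := Real.exp_le_one_iff.2 (by linarith)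
  have h3 := Real.add_one_le_exp (-(t - s))
  have h4 := mul_le_mul_of_nonneg_left h3 (Real.exp_pos (-s)).le
  have h5 := mul_le_mul_of_nonneg_right h2 (sub_nonneg.2 hst)
  rw [h1]
  linarith

theorem PCTSPInstance.IsOptimal.thresholdBound_le {V : Type*} [Fintype V] [DecidableEq V]
    {I : PCTSPInstance V} {x : Sym2 V → ℝ} {y : V → ℝ} (h : I.IsOptimal x y) {γ η : ℝ}
    (hγ : 0 < γ) (hγ1 : γ < 1) (hγη : γ ≤ η) (hη : ∀ v, γ ≤ y v → η ≤ y v) :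
    I.thresholdBound x y η ≤ I.thresholdBound x y γ := by
  have hη0 : 0 < η := hγ.trans_le hγη
  have hfilter : (Finset.univ.filter fun v => y v < η) = Finset.univ.filter fun v => y v < γ := by
    ext v
    simp only [Finset.mem_filter, Finset.mem_univ, true_and]
    exact ⟨fun hv => not_le.1 fun h' => absurd (hη v h') (not_le.2 hv), fun hv => hv.trans_le hγη⟩
  have hinv : 0 ≤ 1 / γ - 1 / η := sub_nonneg.2 (one_div_le_one_div_of_le hγ hγη)
  have hL := h.1.length_nonneg
  have hsum := mul_le_mul_of_nonneg_left (h.sum_penalty_le_length hγ hγ1)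
    (mul_nonneg (by norm_num : (0 : ℝ) ≤ 3 / 4) hinv)
  have hterm : ∑ v : V with y v < γ, Real.exp (-(3 / (4 * η)) * y v) * I.penalty v -
      ∑ v : V with y v < γ, Real.exp (-(3 / (4 * γ)) * y v) * I.penalty v ≤
      3 / 4 * (1 / γ - 1 / η) * ∑ v : V with y v < γ, I.penalty v * y v := by
    rw [← Finset.sum_sub_distrib, Finset.mul_sum]
    refine Finset.sum_le_sum fun v _ => ?_
    have hy := (h.1.y_mem v).1
    have hd : 3 / (4 * γ) * y v - 3 / (4 * η) * y v = 3 / 4 * (1 / γ - 1 / η) * y v := by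
      field_simp
    have hd0 := mul_nonneg (mul_nonneg (by norm_num : (0 : ℝ) ≤ 3 / 4) hinv) hy
    have he := exp_neg_sub_exp_neg_le (s := 3 / (4 * η) * y v) (t := 3 / (4 * γ) * y v)
      (by positivity) (by linarith)
    have := mul_le_mul_of_nonneg_right he (I.penalty_nonneg v)
    rw [hd] at this
    simp only [neg_mul]
    linarith
  have hlen : 3 / (2 * γ) * I.length x - 3 / (2 * η) * I.length x =
      3 / 2 * ((1 / γ - 1 / η) * I.length x) := by
    field_simp
  have hnn := mul_nonneg hinv hL
  simp only [thresholdBound, hfilter]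
  linarith

theorem lemma21 {V : Type*} [Fintype V] [DecidableEq V] (I : PCTSPInstance V)
    (x : Sym2 V → ℝ) (y : V → ℝ) (hopt : I.IsOptimal x y) (α : ℝ) (hα : 0 < α)
    (hγ : ∃ γ ∈ Set.Ioc (0 : ℝ) 1, I.thresholdBound x y γ ≤ α * I.lpValue x y) :
    ∃ v : V, y v ∈ Set.Ioc (0 : ℝ) 1 ∧
      I.thresholdBound x y (y v) ≤ α * I.lpValue x y := by
  obtain ⟨γ, ⟨hγ0, hγ1⟩, hle⟩ := hγ
  -- The penalty bound divides by `1/γ - 1`, so `γ = 1` is separate; there the root serves.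
  rcases hγ1.eq_or_lt with rfl | hγ1
  · exact ⟨I.root, by simp [hopt.1.y_root], by rwa [hopt.1.y_root]⟩
  obtain ⟨v, hv, hmin⟩ := Finset.exists_min_image (Finset.univ.filter fun v => γ ≤ y v) y
    ⟨I.root, by simp [hopt.1.y_root, hγ1.le]⟩
  have hγv : γ ≤ y v := (Finset.mem_filter.1 hv).2
  exact ⟨v, ⟨hγ0.trans_le hγv, (hopt.1.y_mem v).2⟩,
    (hopt.thresholdBound_le hγ0 hγ1 hγv fun w hw => hmin w (by simp [hw])).trans hle⟩
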